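/- Let $\mathcal H=L^2(\mathbb R)$ (complex-valued functions, Lebesgue measure), and for $q,p\in\mathbb R$ let $(U(q)\psi)(x)=\psi(x-q)$ and $(V(p)\psi)(x)=e^{ipx}\psi(x)$. An observable on $\Omega\in\{\mathbb R,\mathbb R^2\}$ is a map $E$ from the Borel sets of $\Omega$ to the bounded operators on $\mathcal H$ which is $\sigma$-additive in the weak operator topology and satisfies $E(X)\ge 0$ for all $X$ and $E(\Omega)=I$. An observable $E$ on $\mathbb R$ is a position observable if $U(q)E(X)U(q)^*=E(X+q)$ and $V(p)E(X)V(p)^*=E(X)$ for all $q,p\in\mathbb R$ and all Borel $X\subseteq\mathbb R$; an observable $F$ on $\mathbb R$ is a momentum observable if $V(p)F(Y)V(p)^*=F(Y+p)$ and $U(q)F(Y)U(q)^*=F(Y)$ for all $q,p\in\mathbb R$ and all Borel $Y\subseteq\mathbb R$. An observable $G$ on $\mathbb R^2$ is a joint observable of $E$ and $F$ if $G(X\times\mathbb R)=E(X)$ and $G(\mathbb R\times Y)=F(Y)$ for all Borel $X,Y\subseteq\mathbb R$. A state is a positive operator $T$ on $\mathcal H$ of trace one, and $p^G_T(Z)=\operatorname{tr}[T\,G(Z)]$.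 Let $G$ be a joint observable of a position observable $E$ and a momentum observable $F$ (no covariance of $G$ under phase space translations is assumed), and let $Z\subseteq\mathbb R^2$ be a bounded Borel set. Then (i) $\|G(Z)\|\neq 1$, where $\|\cdot\|$ is the operator norm; (ii) there exists a number $k_Z<1$ such that for every state $T$, $T\,G(Z)$ is of trace class, its trace $p^G_T(Z)$ is real, and $p^G_T(Z)\le k_Z$. -/

import Mathlib

open MeasureTheory

/-- A (quantum) observable with outcome space `Ω`, i.e. a normalized positive operator measure:
a set function on the σ-algebra of `Ω` with values in the bounded operators on `H` which is
positive, normalized and σ-additive in the weak operator topology.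
The values at non-measurable sets carry no information and are left unrestricted. -/
structure Observable (Ω : Type*) [MeasurableSpace Ω] (H : Type*) [NormedAddCommGroup H]
    [InnerProductSpace ℂ H] where
  /-- the operator assigned to a set of outcomes -/
  toFun : Set Ω → (H →L[ℂ] H)
  positive : ∀ X : Set Ω, MeasurableSet X → (toFun X).IsPositive
  normalized : toFun Set.univ = ContinuousLinearMap.id ℂ H
  sigma_additive : ∀ X : ℕ → Set Ω, (∀ n, MeasurableSet (X n)) →
    Pairwise (Function.onFun Disjoint X) → ∀ φ ψ : H,
      HasSum (fun n => inner ℂ φ (toFun (X n) ψ)) (inner ℂ φ (toFun (⋃ n, X n) ψ))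

instance {Ω : Type*} [MeasurableSpace Ω] {H : Type*} [NormedAddCommGroup H]
    [InnerProductSpace ℂ H] :
    CoeFun (Observable Ω H) (fun _ => Set Ω → (H →L[ℂ] H)) := ⟨Observable.toFun⟩

/-- `G` is a joint observable of `E₁` and `E₂`: its margins are `E₁` and `E₂`. -/
def IsJointObservable {H : Type*} [NormedAddCommGroup H] [InnerProductSpace ℂ H]
    (G : Observable (ℝ × ℝ) H) (E₁ E₂ : Observable ℝ H) : Prop :=
  (∀ X : Set ℝ, MeasurableSet X → E₁ X = G (X ×ˢ Set.univ)) ∧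
  (∀ Y : Set ℝ, MeasurableSet Y → E₂ Y = G (Set.univ ×ˢ Y))

/-- The bounded operator `A` is of trace class with trace `t`: for every orthonormal basis `b`,
the series `∑ i, ⟪b i, A (b i)⟫` is unconditionally summable with sum `t`. -/
def HasTrace {H : Type*} [NormedAddCommGroup H] [InnerProductSpace ℂ H]
    (A : H →L[ℂ] H) (t : ℂ) : Prop :=
  ∀ (w : Set H) (b : HilbertBasis w ℂ H), HasSum (fun i => inner ℂ (b i) (A (b i))) t

theorem HasTrace.unique {H : Type*} [NormedAddCommGroup H] [InnerProductSpace ℂ H]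
    [CompleteSpace H] {A : H →L[ℂ] H} {s t : ℂ} (hs : HasTrace A s) (ht : HasTrace A t) :
    s = t := by
  obtain ⟨w, b, -⟩ := exists_hilbertBasis ℂ H
  exact (hs w b).unique (ht w b)

open Classical in
/-- The trace of an operator of trace class (and `0` for all other operators). -/
noncomputable def opTrace {H : Type*} [NormedAddCommGroup H] [InnerProductSpace ℂ H]
    (A : H →L[ℂ] H) : ℂ :=
  if h : ∃ t, HasTrace A t then h.choose else 0

theorem HasTrace.opTrace_eq {H : Type*} [NormedAddCommGroup H] [InnerProductSpace ℂ H]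
    [CompleteSpace H] {A : H →L[ℂ] H} {t : ℂ} (h : HasTrace A t) : opTrace A = t := by
  have h' : ∃ t, HasTrace A t := ⟨t, h⟩
  rw [opTrace, dif_pos h']
  exact h'.choose_spec.unique h

/-- States: positive operators of trace one. -/
def IsState {H : Type*} [NormedAddCommGroup H] [InnerProductSpace ℂ H]
    (T : H →L[ℂ] H) : Prop :=
  T.IsPositive ∧ HasTrace T 1

/-- The outcome probability `tr[T E(X)]` of the observable `E` in the state `T`. -/
noncomputable def outcomeProb {Ω : Type*} [MeasurableSpace Ω] {H : Type*}
    [NormedAddCommGroup H] [InnerProductSpace ℂ H] (E : Observable Ω H) (T : H →L[ℂ] H)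
    (X : Set Ω) : ℝ :=
  (opTrace (T ∘L E X)).re

/-- The Hilbert space `L²(ℝ)` of complex-valued functions. -/
abbrev L2R : Type := Lp ℂ 2 (volume : Measure ℝ)

/-- Space translations: `(U(q)ψ)(x) = ψ(x - q)`. -/
noncomputable def translationOp (q : ℝ) : L2R →L[ℂ] L2R :=
  (Lp.compMeasurePreservingₗᵢ ℂ (fun x : ℝ => x - q)
    (measurePreserving_sub_right volume q)).toContinuousLinearMap

theorem translationOp_apply (q : ℝ) (ψ : L2R) :
    ∀ᵐ x : ℝ, translationOp q ψ x = ψ (x - q) :=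
  Lp.coeFn_compMeasurePreserving ψ (measurePreserving_sub_right volume q)

theorem memLp_boost (p : ℝ) (ψ : L2R) :
    MemLp (fun x : ℝ => Complex.exp (Complex.I * ((p * x : ℝ) : ℂ)) * ψ x) 2 volume := by
  refine (Lp.memLp ψ).of_le ?_ ?_
  · refine AEStronglyMeasurable.mul ?_ (Lp.aestronglyMeasurable ψ)
    exact Continuous.aestronglyMeasurable (by fun_prop)
  · refine Filter.Eventually.of_forall fun x => ?_
    rw [norm_mul, Complex.norm_exp_I_mul_ofReal, one_mul]

/-- Velocity boosts: `(V(p)ψ)(x) = exp(ipx) ψ(x)`. -/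
noncomputable def boostOp (p : ℝ) : L2R →L[ℂ] L2R :=
  LinearMap.mkContinuous
    { toFun := fun ψ => (memLp_boost p ψ).toLp _
      map_add' := fun ψ φ => by
        apply Lp.ext
        filter_upwards [(memLp_boost p (ψ + φ)).coeFn_toLp, Lp.coeFn_add ψ φ,
          Lp.coeFn_add ((memLp_boost p ψ).toLp _) ((memLp_boost p φ).toLp _),
          (memLp_boost p ψ).coeFn_toLp, (memLp_boost p φ).coeFn_toLp] with x h1 h2 h3 h4 h5
        rw [h1, h3, Pi.add_apply, h4, h5, h2, Pi.add_apply, mul_add]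
      map_smul' := fun c ψ => by
        apply Lp.ext
        filter_upwards [(memLp_boost p (c • ψ)).coeFn_toLp, Lp.coeFn_smul c ψ,
          Lp.coeFn_smul c ((memLp_boost p ψ).toLp _),
          (memLp_boost p ψ).coeFn_toLp] with x h1 h2 h3 h4
        rw [h1, RingHom.id_apply, h3, Pi.smul_apply, h4, h2, Pi.smul_apply, smul_eq_mul,
          smul_eq_mul, mul_left_comm] }
    1 (fun ψ => by
      rw [one_mul]
      refine Lp.norm_le_norm_of_ae_le ?_
      filter_upwards [(memLp_boost p ψ).coeFn_toLp] with x h1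
      simp only [LinearMap.coe_mk, AddHom.coe_mk]
      rw [h1, norm_mul, Complex.norm_exp_I_mul_ofReal, one_mul])

theorem boostOp_apply (p : ℝ) (ψ : L2R) :
    ∀ᵐ x : ℝ, boostOp p ψ x = Complex.exp (Complex.I * ((p * x : ℝ) : ℂ)) * ψ x :=
  (memLp_boost p ψ).coeFn_toLp

/-- Position observables: translation covariant and velocity boost invariant observables,
`U(q) E(X) U(q)* = E(X + q)` and `V(p) E(X) V(p)* = E(X)`. -/
def IsPositionObservable (E : Observable ℝ L2R) : Prop :=
  ∀ (q p : ℝ) (X : Set ℝ), MeasurableSet X →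
    translationOp q ∘L E X ∘L ContinuousLinearMap.adjoint (translationOp q)
      = E ((fun x => x + q) '' X) ∧
    boostOp p ∘L E X ∘L ContinuousLinearMap.adjoint (boostOp p) = E X

/-- Momentum observables: velocity boost covariant and translation invariant observables,
`V(p) F(Y) V(p)* = F(Y + p)` and `U(q) F(Y) U(q)* = F(Y)`. -/
def IsMomentumObservable (F : Observable ℝ L2R) : Prop :=
  ∀ (q p : ℝ) (Y : Set ℝ), MeasurableSet Y →
    boostOp p ∘L F Y ∘L ContinuousLinearMap.adjoint (boostOp p)
      = F ((fun y => y + p) '' Y) ∧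
    translationOp q ∘L F Y ∘L ContinuousLinearMap.adjoint (translationOp q) = F Y

/-! If `Z` lies in the square `[-a, a]²`, then `G Z` is dominated by both `E [-a, a]` and `F [-a,
a]`. No covariance of `G` is needed, only covariance and invariance of its margins.

Boost invariance makes `E [-a, a]` multiplication by a function `g`. By translation covariance its
translates by `|q| ≥ 2a + 1` are effects of intervals disjoint from `[-a, a]`, so `g x + g (x + q) ≤
1` almost everywhere. Hence `g ≤ 2/3` outside a bounded interval, and a state in which `E [-a, a]`
has probability near one has little mass far out (`exists_re_inner_add_tail_le`). Conjugating with
the Fourier transform gives the same for `F` and the momentum tails.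

If the quadratic form of `G Z` came arbitrarily close to one on unit vectors, there would be unit
vectors whose position and momentum tails both tend to zero. Cutting off in position, transforming
and cutting off in momentum is a completely continuous operation, so a subsequence converges in norm
to a unit vector that is compactly supported together with its Fourier transform. Analyticity
forbids this (`not_tendsto_tail_fourier_tail`). So the form of `G Z` is bounded by some `k < 1`,
which bounds both the norm and all traces `tr[T G(Z)]`. -/

open scoped FourierTransform SchwartzMap

/-! ### Positive operators, Hilbert-Schmidt factors and traces. -/

section Trace

variable {H : Type*} [NormedAddCommGroup H] [InnerProductSpace ℂ H]

/-- A positive operator whose quadratic form is bounded by `k` has norm at most `k`. -/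
theorem ContinuousLinearMap.IsPositive.norm_le_of_re_inner_le [CompleteSpace H] {A : H →L[ℂ] H}
    (hA : A.IsPositive) {k : ℝ} (hk : 0 ≤ k)
    (h : ∀ φ : H, (inner ℂ φ (A φ)).re ≤ k * ‖φ‖ ^ 2) : ‖A‖ ≤ k := by
  have hA' : 0 ≤ A := (ContinuousLinearMap.nonneg_iff_isPositive A).2 hA
  rw [CStarAlgebra.norm_le_iff_le_algebraMap A hk hA', ContinuousLinearMap.le_def,
    ContinuousLinearMap.isPositive_def']
  refine ⟨?_, fun x => ?_⟩
  · exact (IsSelfAdjoint.algebraMap _ (IsSelfAdjoint.all k)).sub hA.isSelfAdjoint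
  · rw [ContinuousLinearMap.reApplyInnerSelf_apply, sub_apply, inner_sub_left,
      map_sub]
    have h1 := h x
    have h2 : RCLike.re (inner ℂ (A x) x) = (inner ℂ x (A x)).re := inner_re_symm (𝕜 := ℂ) _ _
    have h3 : RCLike.re (inner ℂ ((algebraMap ℝ (H →L[ℂ] H) k) x) x) = k * ‖x‖ ^ 2 := by
      rw [Algebra.algebraMap_eq_smul_one, smul_apply,
        one_apply_eq_self, RCLike.real_smul_eq_coe_smul (K := ℂ), inner_smul_left,
        inner_self_eq_norm_sq_to_K]
      simp [← Complex.ofReal_pow]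
    linarith

theorem HilbertBasis.hasSum_norm_inner_sq {ι : Type*} (b : HilbertBasis ι ℂ H) (x : H) :
    HasSum (fun i => ‖(inner ℂ (b i) x : ℂ)‖ ^ 2) (‖x‖ ^ 2) := by
  have h := Complex.hasSum_re (b.hasSum_inner_mul_inner x x)
  have h2 : (inner ℂ x x : ℂ).re = ‖x‖ ^ 2 := by
    rw [inner_self_eq_norm_sq_to_K]; norm_cast
  rw [h2] at h
  convert h using 2 with i
  rw [← inner_conj_symm x (b i), RCLike.conj_mul]
  norm_cast

/-- Matrix coefficients of a Hilbert-Schmidt operator and of a bounded multiple of it have summable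
products. -/
theorem summable_inner_mul_inner {ι κ : Type*} {S A : H →L[ℂ] H} (c : HilbertBasis ι ℂ H)
    (b : HilbertBasis κ ℂ H) (hsq : Summable (fun j => ‖S (c j)‖ ^ 2)) :
    Summable (fun p : ι × κ =>
      (inner ℂ (A (S (c p.1))) (b p.2) : ℂ) * inner ℂ (b p.2) (S (c p.1))) := by
  -- The dominating series comes from `αβ ≤ α² + β²`; Parseval in the second index reduces it to a
  -- series controlled by `∑ ‖S (c j)‖²`.
  have hs : Summable (fun p : ι × κ => ‖(inner ℂ (b p.2) (A (S (c p.1))) : ℂ)‖ ^ 2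
      + ‖(inner ℂ (b p.2) (S (c p.1)) : ℂ)‖ ^ 2) := by
    rw [summable_prod_of_nonneg (fun p => by positivity)]
    have hin : ∀ j, HasSum (fun i => ‖(inner ℂ (b i) (A (S (c j))) : ℂ)‖ ^ 2
      + ‖(inner ℂ (b i) (S (c j)) : ℂ)‖ ^ 2) (‖A (S (c j))‖ ^ 2 + ‖S (c j)‖ ^ 2) := fun j =>
      (b.hasSum_norm_inner_sq _).add (b.hasSum_norm_inner_sq _)
    refine ⟨fun j => (hin j).summable, ?_⟩
    simp_rw [fun j => (hin j).tsum_eq]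
    refine Summable.add ?_ hsq
    refine Summable.of_nonneg_of_le (fun j => by positivity) (fun j => ?_)
      (hsq.mul_left (‖A‖ ^ 2))
    rw [← mul_pow]
    gcongr
    exact A.le_opNorm _
  refine Summable.of_norm_bounded hs fun p => ?_
  rw [norm_mul, norm_inner_symm]
  generalize ‖(inner ℂ (b p.2) (A (S (c p.1))) : ℂ)‖ = α
  generalize ‖(inner ℂ (b p.2) (S (c p.1)) : ℂ)‖ = β
  nlinarith [sq_nonneg (α - β), sq_nonneg α, sq_nonneg β]

theorem HasSum.iterated_inner {ι κ : Type*} (b : HilbertBasis κ ℂ H) {x y : ι → H} {s : ℂ}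
    (hs : HasSum (fun p : ι × κ => (inner ℂ (x p.1) (b p.2) : ℂ) * inner ℂ (b p.2) (y p.1)) s) :
    HasSum (fun j => (inner ℂ (x j) (y j) : ℂ)) s :=
  hs.prod_fiberwise fun j => b.hasSum_inner_mul_inner (x j) (y j)

/-- If `S` is Hilbert-Schmidt and symmetric and `A` is bounded and symmetric, then `S² A` has a
trace, which can be computed cyclically. -/
theorem hasTrace_sq_comp {S A : H →L[ℂ] H} (hS : ∀ x y, inner ℂ (S x) y = inner ℂ x (S y))
    (hA : ∀ x y, inner ℂ (A x) y = inner ℂ x (A y)) {w : Set H} (c : HilbertBasis w ℂ H)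
    (hsq : Summable (fun j => ‖S (c j)‖ ^ 2)) :
    HasTrace (S ∘L S ∘L A) (∑' j, inner ℂ (A (S (c j))) (S (c j))) := by
  intro w' b
  -- One unconditionally convergent double series, summed in both orders: over `b` first it yields
  -- the sum along `c`, over `c` first the diagonal of `S² A` along `b`.
  obtain ⟨s, hs⟩ := summable_inner_mul_inner (A := A) c b hsq
  have h1 := HasSum.iterated_inner b (x := fun j => A (S (c j))) (y := fun j => S (c j)) hs
  have hs' : HasSum (fun p : w' × w =>
      (inner ℂ (A (S (c p.2))) (b p.1) : ℂ) * inner ℂ (b p.1) (S (c p.2))) s :=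
    (Equiv.prodComm w' w).hasSum_iff.2 hs
  have h2 : (fun p : w' × w =>
      (inner ℂ (A (S (c p.2))) (b p.1) : ℂ) * inner ℂ (b p.1) (S (c p.2)))
      = fun p => (inner ℂ (S (b p.1)) (c p.2) : ℂ) * inner ℂ (c p.2) (S (A (b p.1))) := by
    funext p
    rw [hA, hS, hS, mul_comm]
  rw [h2] at hs'
  have h3 := HasSum.iterated_inner c (x := fun i => S (b i)) (y := fun i => S (A (b i))) hs'
  rw [h1.tsum_eq]
  convert h3 using 2 with i
  rw [hS]
  rfl

/-- For a state `T` and a positive operator `A` bounded by `k`, the operator `T A` is of trace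
class, and its trace is real and at most `k`. -/
theorem IsState.exists_hasTrace_comp [CompleteSpace H] {T A : H →L[ℂ] H} (hT : IsState T) (hA : A.IsPositive)
    {k : ℝ} (h : ∀ φ : H, (inner ℂ φ (A φ)).re ≤ k * ‖φ‖ ^ 2) :
    ∃ t : ℝ, HasTrace (T ∘L A) t ∧ t ≤ k := by
  have hT' : 0 ≤ T := (ContinuousLinearMap.nonneg_iff_isPositive T).2 hT.1
  -- With `T = S²`, the trace of `T A` becomes `∑ ⟪S (c j), A (S (c j))⟫`, while `∑ ‖S (c j)‖² = tr
  -- T = 1`.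
  obtain ⟨S, hSp, hSS⟩ : ∃ S : H →L[ℂ] H, S.IsPositive ∧ S ∘L S = T :=
    ⟨CFC.sqrt T, (ContinuousLinearMap.nonneg_iff_isPositive _).1 (CFC.sqrt_nonneg T),
      CFC.sqrt_mul_sqrt_self T hT'⟩
  have hSsymm : ∀ x y, inner ℂ (S x) y = inner ℂ x (S y) := hSp.inner_left_eq_inner_right
  have hAsymm : ∀ x y, inner ℂ (A x) y = inner ℂ x (A y) := hA.inner_left_eq_inner_right
  obtain ⟨w, c, -⟩ := exists_hilbertBasis ℂ H
  have hsq : HasSum (fun j => ‖S (c j)‖ ^ 2) 1 := by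
    have := Complex.hasSum_re (hT.2 w c)
    rw [Complex.one_re] at this
    convert this using 2 with j
    rw [← hSS, ContinuousLinearMap.comp_apply, ← hSsymm, inner_self_eq_norm_sq_to_K]; norm_cast
  have hreal : ∀ j, ((inner ℂ (S (c j)) (A (S (c j)))).re : ℂ)
      = inner ℂ (A (S (c j))) (S (c j)) := fun j => by
    rw [hAsymm]
    have h0 := hA.inner_nonneg_right (S (c j))
    exact Complex.ext rfl (by simpa using (Complex.le_def.1 h0).2)
  have hsumA : Summable (fun j => (inner ℂ (S (c j)) (A (S (c j)))).re) := by
    refine Summable.of_nonneg_of_le (fun j => ?_) (fun j => h (S (c j)))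
      (hsq.summable.mul_left k)
    exact hA.re_inner_nonneg_right _
  refine ⟨∑' j, (inner ℂ (S (c j)) (A (S (c j)))).re, ?_, ?_⟩
  · rw [Complex.ofReal_tsum, ← hSS, ContinuousLinearMap.comp_assoc]
    simp_rw [hreal]
    exact hasTrace_sq_comp hSsymm hAsymm c hsq.summable
  · calc _ ≤ ∑' j, k * ‖S (c j)‖ ^ 2 :=
          hsumA.tsum_le_tsum (fun j => h _) (hsq.summable.mul_left k)
      _ = k := by rw [tsum_mul_left, hsq.tsum_eq, mul_one]

end Trace

/-! ### The Fourier transform on `L²(ℝ)`, translations and boosts. -/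

/-- On `L¹ ∩ L²` the Fourier transform is given by the usual integral. -/
theorem Lp.coeFn_fourier_of_integrable (f : L2R) (hf : Integrable f) :
    (𝓕 f : L2R) =ᵐ[volume] 𝓕 (f : ℝ → ℂ) := by
  have hcont : Continuous (𝓕 (f : ℝ → ℂ)) :=
    VectorFourier.fourierIntegral_continuous Real.continuous_fourierChar
      (by simpa using! continuous_inner) hf
  have hloc : LocallyIntegrable (𝓕 f : L2R) := (Lp.memLp (𝓕 f)).locallyIntegrable (by norm_num)
  rw [← sub_ae_eq_zero]
  -- Against a test function both transforms can be moved onto it: for `L²` through tempered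
  -- distributions, for the integral by Fubini.
  refine ae_eq_zero_of_integral_contDiff_smul_eq_zero (hloc.sub hcont.locallyIntegrable)
    fun g hg hgc => ?_
  have hgc' : HasCompactSupport (fun x => (g x : ℂ)) := hgc.comp_left (g := Complex.ofReal) rfl
  have hg' : ContDiff ℝ (⊤ : ℕ∞) (fun x => (g x : ℂ)) := Complex.ofRealCLM.contDiff.comp hg
  set G : 𝓢(ℝ, ℂ) := hgc'.toSchwartzMap hg' with hG
  have hGx : ∀ x, G x = (g x : ℂ) := fun x => rfl
  have h1 := congrArg (fun D => D G) (Lp.fourier_toTemperedDistribution_eq f)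
  simp only [TemperedDistribution.fourier_apply, Lp.toTemperedDistribution_apply] at h1
  have h2 := VectorFourier.integral_fourierIntegral_smul_eq_flip (L := innerₗ ℝ) (μ := volume)
    (ν := volume) Real.continuous_fourierChar (by simpa using! continuous_inner) hf G.integrable
  rw [flip_innerₗ] at h2
  have h3 : ∫ x, (𝓕 (f : ℝ → ℂ)) x * G x = ∫ x, f x * (𝓕 (G : ℝ → ℂ)) x := h2
  have e1 : Integrable (fun x => g x • (𝓕 f : L2R) x) :=
    hloc.integrable_smul_left_of_hasCompactSupport hg.continuous hgc
  have e2 : Integrable (fun x => g x • (𝓕 (f : ℝ → ℂ)) x) :=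
    hcont.locallyIntegrable.integrable_smul_left_of_hasCompactSupport hg.continuous hgc
  simp only [Pi.sub_apply, smul_sub]
  rw [integral_sub e1 e2, sub_eq_zero]
  simp only [smul_eq_mul, SchwartzMap.fourier_coe, hGx] at h1 h3
  simp only [Complex.real_smul]
  rw [← h1]
  simp_rw [mul_comm _ (f _ : ℂ)]
  rw [← h3]
  simp_rw [mul_comm]

/-- An integrable function with vanishing Fourier transform vanishes. -/
theorem Integrable.ae_eq_zero_of_fourier_eq_zero {f : ℝ → ℂ} (hf : Integrable f)
    (h : ∀ ξ, 𝓕 f ξ = 0) : f =ᵐ[volume] 0 := by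
  refine ae_eq_zero_of_integral_contDiff_smul_eq_zero hf.locallyIntegrable fun g hg hgc => ?_
  have hgc' : HasCompactSupport (fun x => (g x : ℂ)) := hgc.comp_left (g := Complex.ofReal) rfl
  have hg' : ContDiff ℝ (⊤ : ℕ∞) (fun x => (g x : ℂ)) := Complex.ofRealCLM.contDiff.comp hg
  set G : 𝓢(ℝ, ℂ) := hgc'.toSchwartzMap hg' with hG
  -- Writing the test function as `𝓕 (𝓕⁻ G)` lets its transform be moved onto `f`.
  have h2 := VectorFourier.integral_fourierIntegral_smul_eq_flip (L := innerₗ ℝ) (μ := volume)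
    (ν := volume) Real.continuous_fourierChar (by simpa using! continuous_inner) hf
    (𝓕⁻ G).integrable
  rw [flip_innerₗ] at h2
  have h3 : ∫ x, (𝓕 f) x * (𝓕⁻ G) x = ∫ x, f x * (𝓕 ((𝓕⁻ G : 𝓢(ℝ, ℂ)) : ℝ → ℂ)) x := h2
  rw [← SchwartzMap.fourier_coe, FourierTransform.fourier_fourierInv_eq] at h3
  simp only [h, zero_mul, integral_zero] at h3
  rw [h3]
  refine integral_congr_ae (.of_forall fun x => ?_)
  simp only [Complex.real_smul, mul_comm]
  rfl

/-- Integrable functions with the same Fourier transform agree. -/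
theorem Integrable.ae_eq_of_fourier_eq {f g : ℝ → ℂ} (hf : Integrable f) (hg : Integrable g)
    (h : ∀ ξ, 𝓕 f ξ = 𝓕 g ξ) : f =ᵐ[volume] g := by
  rw [← sub_ae_eq_zero]
  refine Integrable.ae_eq_zero_of_fourier_eq_zero (hf.sub hg) fun ξ => ?_
  have h1 := congrFun (VectorFourier.fourierIntegral_add (e := Real.fourierChar) (L := innerₗ ℝ)
    Real.continuous_fourierChar (by simpa using! continuous_inner) (hf.sub hg) hg) ξ
  rw [sub_add_cancel] at h1
  have h2 : 𝓕 f ξ = 𝓕 (f - g) ξ + 𝓕 g ξ := h1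
  rwa [h, right_eq_add] at h2

/-- Reduces continuous identities on `L²` to functions whose Fourier transform is an honest
integral. -/
theorem dense_integrable_L2R : Dense {f : L2R | Integrable f} := by
  refine (SchwartzMap.denseRange_toLpCLM (E := ℝ) (F := ℂ) (μ := volume) (p := 2)
    (by norm_num)).mono ?_
  rintro _ ⟨g, rfl⟩
  exact g.integrable.congr (g.coeFn_toLp 2 volume).symm

/-- The Fourier transform turns translations into boosts. -/
theorem fourier_translationOp (q : ℝ) (f : L2R) :
    (𝓕 (translationOp q f) : L2R) = boostOp (-(2 * Real.pi * q)) (𝓕 f) := by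
  refine dense_integrable_L2R.induction (P := fun f : L2R =>
    (𝓕 (translationOp q f) : L2R) = boostOp (-(2 * Real.pi * q)) (𝓕 f)) ?_ ?_ f
  · intro f hf
    have hf' : Integrable (fun x => f (x - q)) := hf.comp_sub_right q
    apply Lp.ext
    filter_upwards [Lp.coeFn_fourier_of_integrable f hf, boostOp_apply (-(2 * Real.pi * q)) (𝓕 f),
      Lp.coeFn_fourier_of_integrable (translationOp q f)
        (hf'.congr (Filter.EventuallyEq.symm (translationOp_apply q f)))] with ξ h1 h2 h3
    rw [h2, h1, h3, Real.fourier_real_eq_integral_exp_smul, Real.fourier_real_eq_integral_exp_smul,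
      ← integral_const_mul]
    have h4 : ∀ᵐ v : ℝ, Complex.exp (↑(-2 * Real.pi * v * ξ) * Complex.I) • translationOp q f v
        = (fun v => Complex.exp (↑(-2 * Real.pi * (v + q) * ξ) * Complex.I) • f v) (v - q) := by
      filter_upwards [translationOp_apply q f] with v hv
      simp only [hv, sub_add_cancel]
    rw [integral_congr_ae h4, integral_sub_right_eq_self (fun v : ℝ =>
      Complex.exp (↑(-2 * Real.pi * (v + q) * ξ) * Complex.I) • f v) q]
    refine integral_congr_ae (.of_forall fun v => ?_)
    simp only [smul_eq_mul]
    rw [← mul_assoc, ← Complex.exp_add]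
    congr 2
    push_cast; ring
  · exact isClosed_eq (by fun_prop) (by fun_prop)

/-- The Fourier transform turns boosts into translations. -/
theorem fourier_boostOp (p : ℝ) (f : L2R) :
    (𝓕 (boostOp p f) : L2R) = translationOp (p / (2 * Real.pi)) (𝓕 f) := by
  refine dense_integrable_L2R.induction (P := fun f : L2R =>
    (𝓕 (boostOp p f) : L2R) = translationOp (p / (2 * Real.pi)) (𝓕 f)) ?_ ?_ f
  · intro f hf
    have hf' : Integrable (boostOp p f) := by
      refine hf.mono (Lp.aestronglyMeasurable _) ?_
      filter_upwards [boostOp_apply p f] with x hx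
      rw [hx, norm_mul, Complex.norm_exp_I_mul_ofReal, one_mul]
    apply Lp.ext
    filter_upwards [translationOp_apply (p / (2 * Real.pi)) (𝓕 f),
      (measurePreserving_sub_right volume (p / (2 * Real.pi))).quasiMeasurePreserving.ae
        (Lp.coeFn_fourier_of_integrable f hf),
      Lp.coeFn_fourier_of_integrable _ hf'] with ξ h1 h2 h3
    rw [h1, h2, h3, Real.fourier_real_eq_integral_exp_smul, Real.fourier_real_eq_integral_exp_smul]
    refine integral_congr_ae ?_
    filter_upwards [boostOp_apply p f] with v hv
    simp only [smul_eq_mul, hv]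
    rw [← mul_assoc, ← Complex.exp_add]
    congr 2
    have := Real.pi_ne_zero
    push_cast
    field_simp
    ring
  · exact isClosed_eq (by fun_prop) (by fun_prop)

/-! ### Operators commuting with boosts as multiplication operators. -/

theorem integrable_conj_mul (u v : L2R) : Integrable (fun x => (starRingEnd ℂ) (u x) * v x) := by
  refine (L2.integrable_inner (𝕜 := ℂ) u v).congr (.of_forall fun x => ?_)
  simp [mul_comm]

theorem inner_eq_integral_conj_mul (u v : L2R) :
    inner ℂ u v = ∫ x, (starRingEnd ℂ) (u x) * v x := by
  rw [L2.inner_def]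
  exact integral_congr_ae (.of_forall fun x => by simp [mul_comm])

theorem integrable_norm_sq (ψ : L2R) : Integrable (fun x => ‖ψ x‖ ^ 2) :=
  (memLp_two_iff_integrable_sq_norm (Lp.aestronglyMeasurable ψ)).1 (Lp.memLp ψ)

theorem norm_sq_eq_integral (ψ : L2R) : ‖ψ‖ ^ 2 = ∫ x, ‖ψ x‖ ^ 2 := by
  have h : (inner ℂ ψ ψ : ℂ) = ((‖ψ‖ ^ 2 : ℝ) : ℂ) := by
    rw [inner_self_eq_norm_sq_to_K]; norm_cast
  rw [inner_eq_integral_conj_mul] at h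
  have h2 : ∀ x, (starRingEnd ℂ) (ψ x) * ψ x = ((‖ψ x‖ ^ 2 : ℝ) : ℂ) := fun x => by
    rw [RCLike.conj_mul]; norm_cast
  simp_rw [h2] at h
  have h3 := integral_ofReal (𝕜 := ℂ) (f := fun x => ‖ψ x‖ ^ 2) (μ := volume)
  exact Complex.ofReal_injective (h.symm.trans h3)

/-- The matrix elements of the boosts determine the integrable function `ū v`, so commutation with
boosts becomes a pointwise identity. -/
theorem fourier_conj_mul (u v : L2R) (ξ : ℝ) :
    𝓕 (fun x => (starRingEnd ℂ) (u x) * v x) ξ = inner ℂ u (boostOp (-(2 * Real.pi * ξ)) v) := by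
  rw [Real.fourier_real_eq_integral_exp_smul, inner_eq_integral_conj_mul]
  refine integral_congr_ae ?_
  filter_upwards [boostOp_apply (-(2 * Real.pi * ξ)) v] with x hx
  have : (Complex.I * ((-(2 * Real.pi * ξ) * x : ℝ) : ℂ))
    = (((-2 * Real.pi * x * ξ : ℝ) : ℂ) * Complex.I) := by push_cast; ring
  rw [hx, smul_eq_mul, this]
  ring

theorem memLp_gaussian : MemLp (fun x : ℝ => (Real.exp (-1 * x ^ 2) : ℂ)) 2 volume := by
  rw [memLp_two_iff_integrable_sq_norm (by fun_prop)]
  refine (integrable_exp_neg_mul_sq (b := 2) (by norm_num)).congr (.of_forall fun x => ?_)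
  simp only [Complex.norm_real, Real.norm_eq_abs, Real.abs_exp]
  rw [← Real.exp_nat_mul]
  congr 1
  push_cast; ring

/-- A symmetric operator commuting with all boosts is a multiplication operator. -/
theorem exists_eq_mul_of_commute_boostOp {A : L2R →L[ℂ] L2R}
    (hA : ∀ u v, inner ℂ (A u) v = inner ℂ u (A v))
    (hV : ∀ p ψ, A (boostOp p ψ) = boostOp p (A ψ)) :
    ∃ f : ℝ → ℂ, StronglyMeasurable f ∧ ∀ ψ, A ψ =ᵐ[volume] fun x => f x * ψ x := by
  have key : ∀ u v : L2R, (fun x => (starRingEnd ℂ) (u x) * (A v) x)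
      =ᵐ[volume] fun x => (starRingEnd ℂ) ((A u) x) * v x := fun u v => by
    have h1 := fourier_conj_mul u (A v)
    simp_rw [← hV, ← hA, ← fourier_conj_mul (A u) v] at h1
    exact Integrable.ae_eq_of_fourier_eq (integrable_conj_mul u (A v))
      (integrable_conj_mul (A u) v) h1
  -- A Gaussian vanishes nowhere, so the multiplier can be recovered from this one vector as `conj
  -- (A u) / u`.
  set u : L2R := memLp_gaussian.toLp _ with hu
  have hm : AEStronglyMeasurable (fun x : ℝ => (starRingEnd ℂ) ((A u) x) *
      ((Real.exp (-1 * x ^ 2))⁻¹ : ℝ)) volume := by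
    refine AEStronglyMeasurable.mul ?_ (Continuous.aestronglyMeasurable ?_)
    · exact Complex.continuous_conj.comp_aestronglyMeasurable (Lp.aestronglyMeasurable _)
    · exact Complex.continuous_ofReal.comp
        (Continuous.inv₀ (by fun_prop) fun x => (Real.exp_pos _).ne')
  refine ⟨hm.mk _, hm.stronglyMeasurable_mk, fun ψ => ?_⟩
  filter_upwards [key u ψ, memLp_gaussian.coeFn_toLp, hm.ae_eq_mk] with x h1 h2 h3
  rw [← h3]
  rw [hu, h2, Complex.conj_ofReal, ← hu] at h1
  have h5 : (Real.exp (-1 * x ^ 2) : ℂ) ≠ 0 := by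
    exact_mod_cast (Real.exp_pos _).ne'
  rw [mul_right_comm, ← h1, mul_right_comm, ← Complex.ofReal_mul, mul_inv_cancel₀ (Real.exp_pos _).ne']
  simp

/-- Testing quadratic forms on indicator functions turns operator bounds into bounds on set
integrals of the multiplier. -/
theorem integral_mul_norm_sq_indicator (g : ℝ → ℝ) {C : Set ℝ} (hC : MeasurableSet C)
    (hC' : volume C ≠ ⊤) :
    ∫ x, g x * ‖(indicatorConstLp 2 hC hC' (1 : ℂ) : L2R) x‖ ^ 2 = ∫ x in C, g x := by
  rw [← integral_indicator hC]
  refine integral_congr_ae ?_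
  filter_upwards [indicatorConstLp_coeFn (p := 2) (hs := hC) (hμs := hC') (c := (1 : ℂ))] with x hx
  rw [hx]
  by_cases h : x ∈ C <;> simp [h]

/-! ### Decay of the multiplier at infinity. -/

/-- Two sets of positive measure have translates whose intersection has positive measure. -/
theorem exists_measure_inter_preimage_add_ne_zero {A B : Set ℝ} (hA : MeasurableSet A)
    (hB : MeasurableSet B) (hA0 : volume A ≠ 0) (hB0 : volume B ≠ 0) :
    ∃ q : ℝ, volume (A ∩ (fun x => x + q) ⁻¹' B) ≠ 0 := by
  by_contra! h
  -- Fubini for `D`: slices at fixed shift are the intersections, while slices at fixed `x ∈ A` are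
  -- translates of `B`.
  set D : Set (ℝ × ℝ) := {p | p.1 ∈ A ∧ p.1 + p.2 ∈ B} with hD
  have hDm : MeasurableSet D :=
    (measurable_fst hA).inter ((measurable_fst.add measurable_snd) hB)
  have h1 : (volume : Measure (ℝ × ℝ)) D = 0 := by
    rw [Measure.volume_eq_prod, Measure.prod_apply_symm hDm]
    simp only [lintegral_eq_zero_iff (measurable_measure_prodMk_right hDm)]
    exact .of_forall fun q => h q
  rw [Measure.volume_eq_prod, Measure.measure_prod_null hDm] at h1
  have h2 : A ⊆ {x | ¬ volume (Prod.mk x ⁻¹' D) = 0} := by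
    intro x hx h0
    apply hB0
    have : Prod.mk x ⁻¹' D = (fun q => x + q) ⁻¹' B := by
      ext q; simp [hD, hx]
    rwa [this, measure_preimage_add] at h0
  exact hA0 (measure_mono_null h2 h1)

/-- A positive operator which commutes with all boosts and whose sum with its translates over
large distances is at most `1` is small far out: it localizes in a bounded interval. -/
theorem exists_re_inner_add_tail_le {A : L2R →L[ℂ] L2R} (hA : A.IsPositive)
    (hV : ∀ p ψ, A (boostOp p ψ) = boostOp p (A ψ)) {q₀ : ℝ}
    (hU : ∀ q, q₀ ≤ |q| → ∀ ψ : L2R, (inner ℂ ψ (A ψ)).re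
      + (inner ℂ (translationOp q ψ) (A (translationOp q ψ))).re ≤ ‖ψ‖ ^ 2) :
    ∃ R : ℝ, ∀ ψ : L2R,
      (inner ℂ ψ (A ψ)).re + 1 / 3 * ∫ x in {x : ℝ | R < |x|}, ‖ψ x‖ ^ 2 ≤ ‖ψ‖ ^ 2 := by
  obtain ⟨f, hf, hfA⟩ := exists_eq_mul_of_commute_boostOp hA.inner_left_eq_inner_right hV
  set g : ℝ → ℝ := fun x => (f x).re with hg
  have hgm : Measurable g := Complex.measurable_re.comp hf.measurable
  have hpt : ∀ ψ : L2R, (fun x => ((starRingEnd ℂ) (ψ x) * (A ψ) x).re)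
      =ᵐ[volume] fun x => g x * ‖ψ x‖ ^ 2 := fun ψ => by
    filter_upwards [hfA ψ] with x hx
    rw [hx, mul_left_comm, RCLike.conj_mul]
    simp only [hg, Complex.coe_algebraMap]
    rw [← Complex.ofReal_pow, Complex.re_mul_ofReal]
  have hint : ∀ ψ : L2R, Integrable (fun x => g x * ‖ψ x‖ ^ 2) := fun ψ =>
    ((integrable_conj_mul ψ (A ψ)).re).congr (hpt ψ)
  have hQ : ∀ ψ : L2R, (inner ℂ ψ (A ψ)).re = ∫ x, g x * ‖ψ x‖ ^ 2 := fun ψ => by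
    rw [inner_eq_integral_conj_mul, ← integral_congr_ae (hpt ψ)]
    exact (integral_re (integrable_conj_mul ψ (A ψ))).symm
  have hon : ∀ C, MeasurableSet C → volume C < ⊤ → IntegrableOn g C := fun C hC hC' => by
    rw [← integrable_indicator_iff hC]
    refine (hint (indicatorConstLp 2 hC hC'.ne (1 : ℂ))).congr ?_
    filter_upwards [indicatorConstLp_coeFn (p := 2) (hs := hC) (hμs := hC'.ne) (c := (1 : ℂ))]
      with x hx
    rw [hx]
    by_cases h : x ∈ C <;> simp [h]
  have hnorm : ∀ (C) (hC : MeasurableSet C) (hC' : volume C < ⊤),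
      ‖(indicatorConstLp 2 hC hC'.ne (1 : ℂ) : L2R)‖ ^ 2 = volume.real C := fun C hC hC' => by
    have := integral_mul_norm_sq_indicator (fun _ => 1) hC hC'.ne
    simp only [one_mul] at this
    rw [norm_sq_eq_integral, this]
    simp
  -- The shift `q₀` is itself admissible since `q₀ ≤ |q₀|`; dropping the nonnegative translated term
  -- leaves `∫_C g ≤ vol C`.
  have hg1 : ∀ᵐ x, g x ≤ 1 := by
    have : 0 ≤ᵐ[volume] fun x => 1 - g x := by
      refine ae_nonneg_of_forall_setIntegral_nonneg_of_sigmaFinite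
        (fun C hC hC' => (integrableOn_const hC'.ne).sub (hon C hC hC')) fun C hC hC' => ?_
      have h0 : IntegrableOn (fun _ => (1 : ℝ)) C := integrableOn_const hC'.ne
      rw [integral_sub h0 (hon C hC hC'),
        ← integral_mul_norm_sq_indicator g hC hC'.ne, ← hQ]
      have h1 := hU q₀ (le_abs_self q₀) (indicatorConstLp 2 hC hC'.ne (1 : ℂ))
      have h2 := hA.re_inner_nonneg_right (translationOp q₀ (indicatorConstLp 2 hC hC'.ne (1 : ℂ)))
      rw [hnorm C hC hC'] at h1
      simp only [integral_const, MeasurableSet.univ, measureReal_restrict_apply, Set.univ_inter,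
        smul_eq_mul, mul_one]
      have h3 : (0 : ℝ) ≤ (inner ℂ (translationOp q₀ (indicatorConstLp 2 hC hC'.ne (1 : ℂ)))
        (A (translationOp q₀ (indicatorConstLp 2 hC hC'.ne (1 : ℂ))))).re := h2
      linarith
    filter_upwards [this] with x hx
    simpa using hx
  -- Any threshold in `(1/2, 1)` would do: two values above it sum to more than one. The choice
  -- `2/3` produces the constant `1/3 = 1 - 2/3`.
  set S : Set ℝ := {x | 2 / 3 < g x} with hS
  have hSm : MeasurableSet S := measurableSet_lt measurable_const hgm
  obtain ⟨R, hR⟩ : ∃ R : ℝ, volume (S ∩ {x | R < |x|}) = 0 := by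
    by_contra! hcon
    have hS0 : volume S ≠ 0 := fun h0 =>
      hcon 0 (measure_mono_null Set.inter_subset_left h0)
    obtain ⟨r, hr⟩ : ∃ r : ℕ, volume (S ∩ Set.Icc (-(r : ℝ)) r) ≠ 0 := by
      by_contra! h
      apply hS0
      refine measure_mono_null (fun x hx => ?_) (measure_iUnion_null h)
      obtain ⟨n, hn⟩ := exists_nat_ge |x|
      exact Set.mem_iUnion.2 ⟨n, hx, abs_le.1 hn⟩
    -- Starting the far piece at `r + q₀` forces `|q| ≥ q₀` for every shift carrying a point of
    -- `[-r, r]` into it. On the resulting set `C` both `g x` and `g (x + q)` exceed `2/3`,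
    -- contradicting `hU`.
    obtain ⟨q, hq⟩ := exists_measure_inter_preimage_add_ne_zero
      (hSm.inter measurableSet_Icc) (hSm.inter
        (measurableSet_lt measurable_const measurable_norm : MeasurableSet {x : ℝ | r + q₀ < |x|}))
      hr (hcon _)
    set C : Set ℝ := (S ∩ Set.Icc (-(r : ℝ)) r) ∩ (fun x => x + q) ⁻¹'
      (S ∩ {x : ℝ | r + q₀ < |x|}) with hC
    have hCm : MeasurableSet C := (hSm.inter measurableSet_Icc).inter
      ((measurable_add_const q) (hSm.inter
        (measurableSet_lt measurable_const measurable_norm : MeasurableSet {x : ℝ | r + q₀ < |x|})))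
    have hCf : volume C < ⊤ := lt_of_le_of_lt
      (measure_mono (Set.inter_subset_left.trans Set.inter_subset_right)) measure_Icc_lt_top
    have hCpos : 0 < volume.real C := ENNReal.toReal_pos hq hCf.ne
    have hq₀ : q₀ ≤ |q| := by
      obtain ⟨x, hx⟩ := nonempty_of_measure_ne_zero hq
      have h1 : |x| ≤ r := abs_le.2 hx.1.2
      have h2 : r + q₀ < |x + q| := hx.2.2
      have := abs_add_le x q
      linarith
    set χ : L2R := indicatorConstLp 2 hCm hCf.ne (1 : ℂ) with hχ
    have h1 := hU q hq₀ χ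
    have hshift : (fun x => g x * ‖translationOp q χ x‖ ^ 2)
        =ᵐ[volume] fun x => (fun y => g (y + q) * ‖χ y‖ ^ 2) (x - q) := by
      filter_upwards [translationOp_apply q χ] with x hx
      simp only [hx, sub_add_cancel]
    have hgq : IntegrableOn (fun y => g (y + q)) C := by
      rw [← integrable_indicator_iff hCm]
      have h2 := ((hint (translationOp q χ)).congr hshift).comp_add_right q
      simp only [add_sub_cancel_right] at h2
      refine h2.congr ?_
      filter_upwards [indicatorConstLp_coeFn (p := 2) (hs := hCm) (hμs := hCf.ne) (c := (1 : ℂ))]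
        with x hx
      rw [hχ, hx]
      by_cases h : x ∈ C <;> simp [h]
    rw [hQ, hQ, hnorm C hCm hCf, integral_congr_ae hshift,
      integral_sub_right_eq_self (fun y => g (y + q) * ‖χ y‖ ^ 2) q,
      integral_mul_norm_sq_indicator g hCm hCf.ne,
      integral_mul_norm_sq_indicator (fun y => g (y + q)) hCm hCf.ne] at h1
    have h2 : ∫ x in C, (2 / 3 : ℝ) ≤ ∫ x in C, g x :=
      setIntegral_mono_on (integrableOn_const hCf.ne) (hon C hCm hCf) hCm
        fun x hx => (show 2 / 3 < g x from hx.1.1).le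
    have h3 : ∫ x in C, (2 / 3 : ℝ) ≤ ∫ x in C, g (x + q) :=
      setIntegral_mono_on (integrableOn_const hCf.ne) hgq hCm
        fun x hx => (show 2 / 3 < g (x + q) from hx.2.1).le
    simp only [integral_const, MeasurableSet.univ, measureReal_restrict_apply, Set.univ_inter,
        smul_eq_mul] at h2 h3
    linarith
  refine ⟨R, fun ψ => ?_⟩
  have hTm : MeasurableSet {x : ℝ | R < |x|} := measurableSet_lt measurable_const measurable_norm
  rw [hQ, norm_sq_eq_integral, ← integral_indicator hTm, ← integral_const_mul,
    ← integral_add (hint ψ) (((integrable_norm_sq ψ).indicator hTm).const_mul _)]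
  refine integral_mono_ae ((hint ψ).add (((integrable_norm_sq ψ).indicator hTm).const_mul _))
    (integrable_norm_sq ψ) ?_
  have hR' : ∀ᵐ x, ¬ (x ∈ S ∩ {x | R < |x|}) := measure_eq_zero_iff_ae_notMem.1 hR
  filter_upwards [hR', hg1] with x hx1 hx2
  by_cases hx : R < |x|
  · have h3 : g x ≤ 2 / 3 := not_lt.1 fun h => hx1 ⟨h, hx⟩
    rw [Set.indicator_of_mem (show x ∈ {x : ℝ | R < |x|} from hx)]
    nlinarith [sq_nonneg ‖ψ x‖]
  · rw [Set.indicator_of_notMem (show x ∉ {x : ℝ | R < |x|} from hx)]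
    nlinarith [sq_nonneg ‖ψ x‖]

/-! ### Weak limits and compactness of position-momentum cut-offs. -/

theorem exists_weak_subseq_limit {H : Type*} [NormedAddCommGroup H] [InnerProductSpace ℂ H]
    [CompleteSpace H] [TopologicalSpace.SeparableSpace H] (φ : ℕ → H) {M : ℝ}
    (hφ : ∀ n, ‖φ n‖ ≤ M) :
    ∃ (θ : ℕ → ℕ) (h : H), StrictMono θ ∧
      ∀ v, Filter.Tendsto (fun n => (inner ℂ v (φ (θ n)) : ℂ)) Filter.atTop
        (nhds (inner ℂ v h)) := by
  -- Sequential Banach-Alaoglu in the dual, transported to `H` by the Riesz isomorphism.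
  obtain ⟨ℓ, -, θ, hθ, hlim⟩ := WeakDual.isSeqCompact_closedBall ℂ H 0 M
    (x := fun n => StrongDual.toWeakDual (InnerProductSpace.toDual ℂ H (φ n)))
    (fun n => by simpa using hφ n)
  refine ⟨θ, (InnerProductSpace.toDual ℂ H).symm (WeakDual.toStrongDual ℓ), hθ, fun v => ?_⟩
  have h1 := ((WeakDual.eval_continuous v).tendsto ℓ).comp hlim
  have h2 := (Complex.continuous_conj.tendsto _).comp h1
  have h3 : (starRingEnd ℂ) (ℓ v)
      = inner ℂ v ((InnerProductSpace.toDual ℂ H).symm (WeakDual.toStrongDual ℓ)) := by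
    rw [← inner_conj_symm, InnerProductSpace.toDual_symm_apply]
    rfl
  rw [← h3]
  refine h2.congr fun n => ?_
  rw [← inner_conj_symm]
  rfl

theorem measurableSet_norm_le (R : ℝ) : MeasurableSet {x : ℝ | |x| ≤ R} :=
  measurableSet_le measurable_norm measurable_const

/-- The orthogonal projection onto the functions supported in `[-R, R]`. -/
noncomputable def cutOp (R : ℝ) : L2R →L[ℂ] L2R :=
  LinearMap.mkContinuous
    { toFun := fun ψ => ((Lp.memLp ψ).indicator (measurableSet_norm_le R)).toLp _
      map_add' := fun ψ φ => by
        rw [← MemLp.toLp_add]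
        refine MemLp.toLp_congr _ _ ?_
        filter_upwards [Lp.coeFn_add ψ φ] with x hx
        by_cases h : x ∈ {x : ℝ | |x| ≤ R}
        · simp only [Pi.add_apply, Set.indicator_of_mem h, hx]
        · simp only [Pi.add_apply, Set.indicator_of_notMem h, add_zero]
      map_smul' := fun c ψ => by
        rw [RingHom.id_apply, ← MemLp.toLp_const_smul]
        refine MemLp.toLp_congr _ _ ?_
        filter_upwards [Lp.coeFn_smul c ψ] with x hx
        by_cases h : x ∈ {x : ℝ | |x| ≤ R}
        · simp only [Pi.smul_apply, Set.indicator_of_mem h, hx]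
        · simp only [Pi.smul_apply, Set.indicator_of_notMem h, smul_zero] }
    1 (fun ψ => by
      rw [one_mul]
      refine Lp.norm_le_norm_of_ae_le ?_
      filter_upwards [((Lp.memLp ψ).indicator (measurableSet_norm_le R)).coeFn_toLp] with x h1
      simp only [LinearMap.coe_mk, AddHom.coe_mk]
      rw [h1]
      exact norm_indicator_le_norm_self _ _)

theorem cutOp_apply (R : ℝ) (ψ : L2R) :
    cutOp R ψ =ᵐ[volume] Set.indicator {x : ℝ | |x| ≤ R} ψ :=
  ((Lp.memLp ψ).indicator (measurableSet_norm_le R)).coeFn_toLp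

theorem norm_cutOp_sq (R : ℝ) (ψ : L2R) :
    ‖cutOp R ψ‖ ^ 2 = ∫ x in {x : ℝ | |x| ≤ R}, ‖ψ x‖ ^ 2 := by
  rw [norm_sq_eq_integral, ← integral_indicator (measurableSet_norm_le R)]
  refine integral_congr_ae ?_
  filter_upwards [cutOp_apply R ψ] with x hx
  rw [hx]
  by_cases h : x ∈ {x : ℝ | |x| ≤ R} <;> simp [h]

theorem norm_sub_cutOp_sq (R : ℝ) (ψ : L2R) :
    ‖ψ - cutOp R ψ‖ ^ 2 = ∫ x in {x : ℝ | R < |x|}, ‖ψ x‖ ^ 2 := by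
  have hm : MeasurableSet {x : ℝ | R < |x|} := measurableSet_lt measurable_const measurable_norm
  rw [norm_sq_eq_integral, ← integral_indicator hm]
  refine integral_congr_ae ?_
  filter_upwards [cutOp_apply R ψ, Lp.coeFn_sub ψ (cutOp R ψ)] with x hx hx'
  rw [hx', Pi.sub_apply, hx]
  by_cases h : |x| ≤ R
  · simp [h, Set.indicator, not_lt.2 h]
  · simp [h, Set.indicator, not_le.1 h]

theorem integrable_indicator_norm_le (R : ℝ) (ψ : L2R) :
    Integrable (Set.indicator {x : ℝ | |x| ≤ R} ψ) := by
  rw [integrable_indicator_iff (measurableSet_norm_le R)]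
  have h : {x : ℝ | |x| ≤ R} = Set.Icc (-R) R := by ext x; simp [abs_le]
  rw [h]
  exact ((Lp.memLp ψ).locallyIntegrable (by norm_num)).integrableOn_isCompact isCompact_Icc

theorem volume_norm_le_ne_top (R : ℝ) : volume {x : ℝ | |x| ≤ R} ≠ ⊤ := by
  have h : {x : ℝ | |x| ≤ R} = Set.Icc (-R) R := by ext x; simp [abs_le]
  rw [h]
  exact measure_Icc_lt_top.ne

theorem fourier_cutOp (R : ℝ) (ψ : L2R) :
    (𝓕 (cutOp R ψ) : L2R) =ᵐ[volume] 𝓕 (Set.indicator {x : ℝ | |x| ≤ R} ψ) := by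
  refine (Lp.coeFn_fourier_of_integrable _
    ((integrable_indicator_norm_le R ψ).congr (cutOp_apply R ψ).symm)).trans
    (.of_eq ?_)
  funext ξ
  rw [Real.fourier_real_eq_integral_exp_smul, Real.fourier_real_eq_integral_exp_smul]
  refine integral_congr_ae ?_
  filter_upwards [cutOp_apply R ψ] with x hx
  rw [hx]

theorem norm_boostOp_apply_le (p : ℝ) (ψ : L2R) : ‖boostOp p ψ‖ ≤ ‖ψ‖ := by
  refine Lp.norm_le_norm_of_ae_le ?_
  filter_upwards [boostOp_apply p ψ] with x hx
  rw [hx, norm_mul, Complex.norm_exp_I_mul_ofReal, one_mul]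

/-- After a position cut-off, values of the transform are inner products with vectors depending only
on `ξ`, so weak convergence yields pointwise convergence. -/
theorem fourier_cutOp_eq_inner (R : ℝ) (ψ : L2R) :
    (𝓕 (cutOp R ψ) : L2R) =ᵐ[volume] fun ξ => inner ℂ
      (indicatorConstLp 2 (measurableSet_norm_le R) (volume_norm_le_ne_top R) (1 : ℂ) : L2R)
      (boostOp (-(2 * Real.pi * ξ)) ψ) := by
  refine (fourier_cutOp R ψ).trans (.of_eq ?_)
  funext ξ
  rw [← fourier_conj_mul, Real.fourier_real_eq_integral_exp_smul,
    Real.fourier_real_eq_integral_exp_smul]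
  refine integral_congr_ae ?_
  filter_upwards [indicatorConstLp_coeFn (p := 2) (hs := measurableSet_norm_le R)
    (hμs := volume_norm_le_ne_top R) (c := (1 : ℂ))] with x hx
  rw [hx]
  by_cases h : x ∈ {x : ℝ | |x| ≤ R} <;> simp [h]

/-- Localizing in position and then in momentum is completely continuous. -/
theorem tendsto_cutOp_fourier_cutOp (R R' : ℝ) {v : ℕ → L2R} {M : ℝ} (hM : ∀ n, ‖v n‖ ≤ M)
    (hv : ∀ u : L2R, Filter.Tendsto (fun n => (inner ℂ u (v n) : ℂ)) Filter.atTop (nhds 0)) :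
    Filter.Tendsto (fun n => cutOp R' (𝓕 (cutOp R (v n)))) Filter.atTop (nhds 0) := by
  rw [tendsto_zero_iff_norm_tendsto_zero]
  suffices h : Filter.Tendsto (fun n => ‖cutOp R' (𝓕 (cutOp R (v n)))‖ ^ 2) Filter.atTop
      (nhds 0) by
    have := (Real.continuous_sqrt.tendsto 0).comp h
    simpa [Function.comp_def] using this
  simp_rw [norm_cutOp_sq]
  set u : L2R := indicatorConstLp 2 (measurableSet_norm_le R) (volume_norm_le_ne_top R) (1 : ℂ)
    with hu
  have hM0 : 0 ≤ M := (norm_nonneg _).trans (hM 0)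
  have hae : ∀ᵐ ξ, ∀ n, (𝓕 (cutOp R (v n)) : L2R) ξ
      = inner ℂ u (boostOp (-(2 * Real.pi * ξ)) (v n)) :=
    ae_all_iff.2 fun n => fourier_cutOp_eq_inner R (v n)
  -- The momentum cut-off supplies a domain of finite measure, on which a constant dominates.
  have hlim := tendsto_integral_of_dominated_convergence
    (μ := volume.restrict {x : ℝ | |x| ≤ R'})
    (F := fun n ξ => ‖(𝓕 (cutOp R (v n)) : L2R) ξ‖ ^ 2) (f := fun _ => (0 : ℝ))
    (fun _ => (‖u‖ * M) ^ 2)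
    (fun n => ((Lp.aestronglyMeasurable _).norm.pow 2).restrict)
    (integrableOn_const (volume_norm_le_ne_top R'))
    (fun n => ae_restrict_of_ae ?_) (ae_restrict_of_ae ?_)
  · simpa using hlim
  · filter_upwards [hae] with ξ hξ
    rw [hξ, norm_pow, norm_norm]
    gcongr
    refine (norm_inner_le_norm _ _).trans ?_
    gcongr
    exact (norm_boostOp_apply_le _ _).trans (hM n)
  · filter_upwards [hae] with ξ hξ
    have h1 := hv (ContinuousLinearMap.adjoint (boostOp (-(2 * Real.pi * ξ))) u)
    simp_rw [ContinuousLinearMap.adjoint_inner_left] at h1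
    simp_rw [hξ]
    simpa using (h1.norm.pow 2)

/-! ### Uniqueness by analyticity. -/

/-- The Fourier-Laplace transform of a compactly supported integrable function is entire. -/
theorem differentiable_integral_exp_mul {c : ℝ → ℂ} (hc : Integrable c) {R : ℝ}
    (hR : ∀ x, R < |x| → c x = 0) :
    Differentiable ℂ (fun z : ℂ => ∫ x : ℝ, Complex.exp (z * x) * c x) := by
  intro z₀
  have hmeas : ∀ z : ℂ, AEStronglyMeasurable (fun x : ℝ => Complex.exp (z * x) * c x) volume :=
    fun z => (Continuous.aestronglyMeasurable (by fun_prop)).mul hc.aestronglyMeasurable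
  have hexp : ∀ (z : ℂ) (x : ℝ), |x| ≤ R → ‖Complex.exp (z * x)‖ ≤ Real.exp (‖z‖ * R) :=
    fun z x hx => by
      refine (Complex.norm_exp_le_exp_norm _).trans (Real.exp_le_exp.2 ?_)
      rw [norm_mul, Complex.norm_real, Real.norm_eq_abs]
      gcongr
  have hF : Integrable (fun x : ℝ => Complex.exp (z₀ * x) * c x) := by
    refine (hc.norm.const_mul (Real.exp (‖z₀‖ * R))).mono' (hmeas z₀) (.of_forall fun x => ?_)
    by_cases hx : |x| ≤ R
    · rw [norm_mul]
      gcongr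
      exact hexp z₀ x hx
    · simp [hR x (not_le.1 hx)]
  refine (hasDerivAt_integral_of_dominated_loc_of_deriv_le (μ := volume)
    (F := fun (z : ℂ) (x : ℝ) => Complex.exp (z * x) * c x)
    (F' := fun (z : ℂ) (x : ℝ) => Complex.exp (z * x) * x * c x)
    (bound := fun x => Real.exp ((‖z₀‖ + 1) * R) * R * ‖c x‖)
    (Metric.ball_mem_nhds z₀ one_pos) (.of_forall hmeas) hF ?_ (.of_forall fun x z hz => ?_)
    (hc.norm.const_mul _) (.of_forall fun x z hz => ?_)).2.differentiableAt
  · exact (Continuous.aestronglyMeasurable (by fun_prop)).mul hc.aestronglyMeasurable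
  · by_cases hx : |x| ≤ R
    · have hR0 : 0 ≤ R := (abs_nonneg x).trans hx
      have hz1 : ‖z‖ ≤ ‖z₀‖ + 1 := by
        have h1 := norm_add_le z₀ (z - z₀)
        rw [add_sub_cancel] at h1
        have h2 := mem_ball_iff_norm.1 hz
        linarith
      rw [norm_mul, norm_mul, Complex.norm_real, Real.norm_eq_abs]
      gcongr
      refine (hexp z x hx).trans (Real.exp_le_exp.2 ?_)
      gcongr
    · simp [hR x (not_le.1 hx)]
  · have h1 : HasDerivAt (fun z : ℂ => z * (x : ℂ)) (x : ℂ) z := hasDerivAt_mul_const _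
    exact (h1.cexp).mul_const _

/-- A function cannot be compactly supported together with its Fourier transform. -/
theorem eq_zero_of_cutOp_eq_of_cutOp_fourier_eq {R R' : ℝ} {χ : L2R} (h1 : cutOp R χ = χ)
    (h2 : cutOp R' (𝓕 χ) = 𝓕 χ) : χ = 0 := by
  set c : ℝ → ℂ := Set.indicator {x : ℝ | |x| ≤ R} χ with hc
  have hci : Integrable c := integrable_indicator_norm_le R χ
  set Φ : ℂ → ℂ := fun z => ∫ x : ℝ, Complex.exp (z * x) * c x with hΦ
  have hΦd : Differentiable ℂ Φ := differentiable_integral_exp_mul hci (R := R) fun x hx => by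
    simp [hc, not_le.2 hx]
  have hχΦ : (𝓕 χ : L2R) =ᵐ[volume] fun ξ : ℝ => Φ (-2 * Real.pi * Complex.I * ξ) := by
    have h3 := fourier_cutOp R χ
    rw [h1] at h3
    refine h3.trans (.of_eq ?_)
    funext ξ
    rw [Real.fourier_real_eq_integral_exp_smul]
    refine integral_congr_ae (.of_forall fun x => ?_)
    simp only [smul_eq_mul, hc]
    congr 2
    push_cast; ring
  set Ψ : ℂ → ℂ := fun z => Φ (-2 * Real.pi * Complex.I * z) with hΨ
  have hΨd : Differentiable ℂ Ψ := hΦd.comp (by fun_prop)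
  have hzero : (fun ξ : ℝ => Ψ ξ) =ᵐ[volume.restrict (Set.Ioi R')] fun _ => 0 := by
    have h4 := cutOp_apply R' (𝓕 χ)
    rw [h2] at h4
    rw [Filter.EventuallyEq, ae_restrict_iff' measurableSet_Ioi]
    filter_upwards [hχΦ, h4] with ξ h5 h6 h7
    rw [hΨ]
    simp only
    rw [← h5, h6]
    have : ¬ |ξ| ≤ R' := not_le.2 (lt_of_lt_of_le h7 (le_abs_self ξ))
    simp [this]
  have hzero' := Measure.eqOn_open_of_ae_eq hzero isOpen_Ioi
    (hΨd.continuous.comp Complex.continuous_ofReal).continuousOn continuousOn_const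
  -- By continuity `Ψ` vanishes everywhere on `(R', ∞)`; the point `R' + 1` is interior, hence an
  -- accumulation point of zeros.
  have hfreq : ∃ᶠ z in nhdsWithin ((R' + 1 : ℝ) : ℂ) {((R' + 1 : ℝ) : ℂ)}ᶜ, Ψ z = 0 := by
    have ht : Filter.Tendsto (fun x : ℝ => (x : ℂ)) (nhdsWithin (R' + 1) {R' + 1}ᶜ)
        (nhdsWithin ((R' + 1 : ℝ) : ℂ) {((R' + 1 : ℝ) : ℂ)}ᶜ) := by
      refine tendsto_nhdsWithin_iff.2 ⟨(Complex.continuous_ofReal.tendsto _).mono_left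
        nhdsWithin_le_nhds, ?_⟩
      filter_upwards [self_mem_nhdsWithin] with x hx h
      exact hx (Complex.ofReal_injective h)
    refine ht.frequently (Filter.Eventually.frequently ?_)
    filter_upwards [nhdsWithin_le_nhds (Ioi_mem_nhds (lt_add_one R'))] with x hx
    exact hzero' hx
  have hall := AnalyticOnNhd.eqOn_zero_of_preconnected_of_frequently_eq_zero
    (fun z _ => hΨd.analyticAt z) isPreconnected_univ (Set.mem_univ _) hfreq
  have h𝓕 : (𝓕 χ : L2R) = 0 := by
    apply Lp.ext
    filter_upwards [hχΦ, Lp.coeFn_zero ℂ 2 (volume : Measure ℝ)] with ξ h5 h6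
    rw [h5, h6]
    exact hall (Set.mem_univ (ξ : ℂ))
  rw [← norm_eq_zero, ← Lp.norm_fourier_eq, h𝓕, norm_zero]

/-! ### No asymptotic concentration in both position and momentum. -/

theorem Lp.fourier_sub (f g : L2R) : (𝓕 (f - g) : L2R) = 𝓕 f - 𝓕 g :=
  (Lp.fourierTransformₗᵢ ℝ ℂ).map_sub f g

/-- Unit vectors cannot be asymptotically concentrated in bounded sets both in position and in
momentum. -/
theorem not_tendsto_tail_fourier_tail {R R' : ℝ} {φ : ℕ → L2R} (hφ : ∀ n, ‖φ n‖ = 1)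
    (h1 : Filter.Tendsto (fun n => ∫ x in {x : ℝ | R < |x|}, ‖φ n x‖ ^ 2) Filter.atTop (nhds 0))
    (h2 : Filter.Tendsto (fun n => ∫ x in {x : ℝ | R' < |x|}, ‖(𝓕 (φ n) : L2R) x‖ ^ 2)
      Filter.atTop (nhds 0)) : False := by
  have : Fact ((2 : ENNReal) ≠ ⊤) := ⟨by norm_num⟩
  have hsq : ∀ ψ : ℕ → L2R, Filter.Tendsto (fun n => ‖ψ n‖ ^ 2) Filter.atTop (nhds 0) →
      Filter.Tendsto ψ Filter.atTop (nhds 0) := fun ψ h => by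
    rw [tendsto_zero_iff_norm_tendsto_zero]
    have := (Real.continuous_sqrt.tendsto 0).comp h
    simpa [Function.comp_def] using this
  simp_rw [← norm_sub_cutOp_sq] at h1 h2
  replace h1 := hsq _ h1
  replace h2 := hsq _ h2
  obtain ⟨θ, h, hθ, hweak⟩ := exists_weak_subseq_limit φ (fun n => (hφ n).le)
  set K : L2R → L2R := fun ψ => cutOp R' (𝓕 (cutOp R ψ)) with hK
  have hKlim : Filter.Tendsto (fun n => K (φ (θ n) - h)) Filter.atTop (nhds 0) := by
    refine tendsto_cutOp_fourier_cutOp R R' (M := 1 + ‖h‖) (fun n => ?_) fun u => ?_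
    · exact (norm_sub_le _ _).trans (by rw [hφ])
    · simpa [inner_sub_right] using (hweak u).sub_const (inner ℂ u h)
  -- With `P`, `P'` the two cut-offs, `𝓕φ - Kφ = (𝓕φ - P'𝓕φ) + P'𝓕(φ - Pφ)`, and both terms tend to
  -- zero by the tail hypotheses.
  have hdiff : Filter.Tendsto (fun n => 𝓕 (φ (θ n)) - K (φ (θ n))) Filter.atTop (nhds 0) := by
    have h3 : Filter.Tendsto (fun n => cutOp R' (𝓕 (φ n - cutOp R (φ n)))) Filter.atTop
        (nhds 0) := by
      have hcont : Continuous (fun ψ : L2R => cutOp R' (𝓕 ψ)) := by fun_prop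
      have := (hcont.tendsto 0).comp h1
      simpa [FourierTransform.fourier_zero] using! this
    have h4 := (h2.add h3).comp hθ.tendsto_atTop
    rw [add_zero] at h4
    refine h4.congr fun n => ?_
    simp only [Function.comp_apply, hK, Lp.fourier_sub, map_sub]
    abel
  have hlim : Filter.Tendsto (fun n => (𝓕 (φ (θ n)) : L2R)) Filter.atTop (nhds (K h)) := by
    have h5 := (hdiff.add hKlim).add_const (K h)
    simp only [zero_add] at h5
    refine h5.congr fun n => ?_
    simp only [hK, Lp.fourier_sub, map_sub]
    abel
  -- The transforms converge in norm, so the vectors themselves do; the limit therefore keeps norm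
  -- one and inherits both supports.
  have hlim' : Filter.Tendsto (fun n => φ (θ n)) Filter.atTop (nhds (𝓕⁻ (K h))) := by
    have hcont : Continuous (fun ψ : L2R => (𝓕⁻ ψ : L2R)) := by fun_prop
    refine ((hcont.tendsto _).comp hlim).congr fun n => ?_
    simp
  set χ : L2R := 𝓕⁻ (K h) with hχ
  have hχ1 : ‖χ‖ = 1 := tendsto_nhds_unique hlim'.norm (by simp [hφ])
  have hc1 : χ - cutOp R χ = 0 := tendsto_nhds_unique
    (hlim'.sub (((cutOp R).continuous.tendsto χ).comp hlim')) (h1.comp hθ.tendsto_atTop)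
  have hc2 : 𝓕 χ - cutOp R' (𝓕 χ) = 0 := by
    have hF : (𝓕 χ : L2R) = K h := by simp [hχ]
    rw [hF]
    exact tendsto_nhds_unique
      (hlim.sub (((cutOp R').continuous.tendsto _).comp hlim)) (h2.comp hθ.tendsto_atTop)
  have := eq_zero_of_cutOp_eq_of_cutOp_fourier_eq (sub_eq_zero.1 hc1).symm (sub_eq_zero.1 hc2).symm
  rw [this, norm_zero] at hχ1
  exact zero_ne_one hχ1

/-! ### Probability bounds from additivity and covariance. -/

section Observable

variable {Ω H : Type*} [MeasurableSpace Ω] [NormedAddCommGroup H] [InnerProductSpace ℂ H]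

theorem Observable.re_inner_nonneg (E : Observable Ω H) {A : Set Ω} (hA : MeasurableSet A) (ψ : H) :
    0 ≤ (inner ℂ ψ (E A ψ) : ℂ).re :=
  (E.positive A hA).re_inner_nonneg_right ψ

theorem Observable.re_inner_add_le (E : Observable Ω H) {A B : Set Ω} (hA : MeasurableSet A)
    (hB : MeasurableSet B) (hAB : Disjoint A B) (ψ : H) :
    (inner ℂ ψ (E A ψ) : ℂ).re + (inner ℂ ψ (E B ψ) : ℂ).re
      ≤ (inner ℂ ψ (E (A ∪ B) ψ) : ℂ).re := by
  -- The sequence `A, B, ∅, ∅, …`; bounding the first two terms by the whole sum avoids evaluating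
  -- the observable at `∅`.
  set X : ℕ → Set Ω := fun n => if n = 0 then A else if n = 1 then B else ∅ with hX
  have hXm : ∀ n, MeasurableSet (X n) := fun n => by
    simp only [hX]; split_ifs <;> simp [hA, hB]
  have hXd : Pairwise (Function.onFun Disjoint X) := fun m n hmn => by
    simp only [hX, Function.onFun]
    split_ifs <;> simp_all [hAB.symm]
  have hXu : ⋃ n, X n = A ∪ B := by
    ext x
    simp only [Set.mem_iUnion, Set.mem_union, hX]
    constructor
    · rintro ⟨n, hn⟩
      split_ifs at hn
      · exact .inl hn
      · exact .inr hn
      · exact hn.elim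
    · rintro (h | h)
      · exact ⟨0, by simpa using h⟩
      · exact ⟨1, by simpa using h⟩
  have h := Complex.hasSum_re (E.sigma_additive X hXm hXd ψ ψ)
  rw [hXu] at h
  have h2 := sum_le_hasSum (Finset.range 2) (fun n _ => E.re_inner_nonneg (hXm n) ψ) h
  simpa [Finset.sum_range_succ, hX] using h2

theorem Observable.re_inner_mono (E : Observable Ω H) {A B : Set Ω} (hA : MeasurableSet A)
    (hB : MeasurableSet B) (hAB : A ⊆ B) (ψ : H) :
    (inner ℂ ψ (E A ψ) : ℂ).re ≤ (inner ℂ ψ (E B ψ) : ℂ).re := by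
  have h := E.re_inner_add_le hA (hB.diff hA) Set.disjoint_sdiff_right ψ
  rw [Set.union_sdiff_cancel hAB] at h
  linarith [E.re_inner_nonneg (hB.diff hA) ψ]

theorem Observable.re_inner_add_le_norm_sq (E : Observable Ω H) {A B : Set Ω}
    (hA : MeasurableSet A) (hB : MeasurableSet B) (hAB : Disjoint A B) (ψ : H) :
    (inner ℂ ψ (E A ψ) : ℂ).re + (inner ℂ ψ (E B ψ) : ℂ).re ≤ ‖ψ‖ ^ 2 := by
  refine (E.re_inner_add_le hA hB hAB ψ).trans
    ((E.re_inner_mono (hA.union hB) .univ (Set.subset_univ _) ψ).trans ?_)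
  rw [E.normalized, ContinuousLinearMap.id_apply, inner_self_eq_norm_sq_to_K]
  exact le_of_eq (by norm_cast)

end Observable

/-- An isometry satisfies `W* W = 1`, which suffices to cancel the adjoint when acting on `W ψ`. -/
theorem intertwine_of_conj_eq {H : Type*} [NormedAddCommGroup H] [InnerProductSpace ℂ H]
    [CompleteSpace H] {W A B : H →L[ℂ] H} (hW : ∀ x, ‖W x‖ = ‖x‖)
    (h : W ∘L A ∘L ContinuousLinearMap.adjoint W = B) (ψ : H) : B (W ψ) = W (A ψ) := by
  have h1 := (ContinuousLinearMap.norm_map_iff_adjoint_comp_self W).1 hW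
  have h2 : ContinuousLinearMap.adjoint W (W ψ) = ψ := congrArg (fun T => T ψ) h1
  rw [← h, ContinuousLinearMap.comp_apply, ContinuousLinearMap.comp_apply, h2]

/-- An observable on the line which is covariant under isometries `W q` assigns almost
complementary probabilities to an interval in states which are far apart. -/
theorem Observable.re_inner_add_re_inner_le {H : Type*} [NormedAddCommGroup H]
    [InnerProductSpace ℂ H] [CompleteSpace H] (E : Observable ℝ H) {W : ℝ → H →L[ℂ] H}
    (hW : ∀ q x, ‖W q x‖ = ‖x‖)
    (hE : ∀ q X, MeasurableSet X → W q ∘L E X ∘L ContinuousLinearMap.adjoint (W q)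
      = E ((fun x => x + q) '' X)) {a q : ℝ} (hq : 2 * a + 1 ≤ |q|) (ψ : H) :
    (inner ℂ ψ (E (Set.Icc (-a) a) ψ) : ℂ).re
      + (inner ℂ (W q ψ) (E (Set.Icc (-a) a) (W q ψ)) : ℂ).re ≤ ‖ψ‖ ^ 2 := by
  -- This is the interval that the shift by `q` carries onto `[-a, a]`; it is disjoint from `[-a,
  -- a]` because `|q| > 2a`.
  have h1 := hE q (Set.Icc (-a - q) (a - q)) measurableSet_Icc
  rw [Set.image_add_const_Icc, sub_add_cancel, sub_add_cancel] at h1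
  have h2 : ∀ x y, inner ℂ (W q x) (W q y) = (inner ℂ x y : ℂ) :=
    (ContinuousLinearMap.inner_map_map_iff_adjoint_comp_self (W q)).2
      ((ContinuousLinearMap.norm_map_iff_adjoint_comp_self (W q)).1 (hW q))
  rw [intertwine_of_conj_eq (hW q) h1, h2]
  refine E.re_inner_add_le_norm_sq measurableSet_Icc measurableSet_Icc ?_ ψ
  rw [Set.disjoint_left]
  rintro x ⟨h3, h4⟩ ⟨h5, h6⟩
  rcases le_abs.1 hq with h | h <;> linarith

theorem norm_boostOp_apply (p : ℝ) (ψ : L2R) : ‖boostOp p ψ‖ = ‖ψ‖ := by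
  refine le_antisymm (norm_boostOp_apply_le p ψ) (Lp.norm_le_norm_of_ae_le ?_)
  filter_upwards [boostOp_apply p ψ] with x hx
  rw [hx, norm_mul, Complex.norm_exp_I_mul_ofReal, one_mul]

theorem norm_translationOp_apply (q : ℝ) (ψ : L2R) : ‖translationOp q ψ‖ = ‖ψ‖ :=
  LinearIsometry.norm_map _ ψ

theorem IsPositionObservable.exists_re_inner_add_tail_le {E : Observable ℝ L2R}
    (hE : IsPositionObservable E) (a : ℝ) :
    ∃ R : ℝ, ∀ ψ : L2R, (inner ℂ ψ (E (Set.Icc (-a) a) ψ)).re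
      + 1 / 3 * ∫ x in {x : ℝ | R < |x|}, ‖ψ x‖ ^ 2 ≤ ‖ψ‖ ^ 2 :=
  _root_.exists_re_inner_add_tail_le (E.positive _ measurableSet_Icc)
    (fun p ψ => intertwine_of_conj_eq (norm_boostOp_apply p) (hE 0 p _ measurableSet_Icc).2 ψ)
    fun _ hq ψ => E.re_inner_add_re_inner_le norm_translationOp_apply
      (fun q X hX => (hE q 0 X hX).1) hq ψ

theorem fourierInv_boostOp (p : ℝ) (ψ : L2R) :
    (𝓕⁻ (boostOp p ψ) : L2R) = translationOp (-(p / (2 * Real.pi))) (𝓕⁻ ψ) := by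
  apply (Lp.fourierTransformₗᵢ ℝ ℂ).injective
  have h1 : (𝓕 (𝓕⁻ (boostOp p ψ) : L2R) : L2R)
      = 𝓕 (translationOp (-(p / (2 * Real.pi))) (𝓕⁻ ψ)) := by
    rw [fourier_translationOp, FourierTransform.fourier_fourierInv_eq,
      FourierTransform.fourier_fourierInv_eq]
    congr 2
    have := Real.pi_ne_zero
    field_simp
  exact h1

theorem fourierInv_translationOp (q : ℝ) (ψ : L2R) :
    (𝓕⁻ (translationOp q ψ) : L2R) = boostOp (2 * Real.pi * q) (𝓕⁻ ψ) := by
  apply (Lp.fourierTransformₗᵢ ℝ ℂ).injective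
  have h1 : (𝓕 (𝓕⁻ (translationOp q ψ) : L2R) : L2R) = 𝓕 (boostOp (2 * Real.pi * q) (𝓕⁻ ψ)) := by
    rw [fourier_boostOp, FourierTransform.fourier_fourierInv_eq,
      FourierTransform.fourier_fourierInv_eq]
    congr 2
    have := Real.pi_ne_zero
    field_simp
  exact h1

/-- The Fourier transform exchanges boosts and translations up to factors of `2π`, so the conjugated
effect satisfies the hypotheses of the position case. -/
theorem IsMomentumObservable.exists_re_inner_add_tail_le {F : Observable ℝ L2R}
    (hF : IsMomentumObservable F) (a : ℝ) :
    ∃ R : ℝ, ∀ ψ : L2R, (inner ℂ ψ (F (Set.Icc (-a) a) ψ)).re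
      + 1 / 3 * ∫ x in {x : ℝ | R < |x|}, ‖(𝓕 ψ : L2R) x‖ ^ 2 ≤ ‖ψ‖ ^ 2 := by
  set W : L2R →L[ℂ] L2R :=
    (Lp.fourierTransformₗᵢ ℝ ℂ).toContinuousLinearEquiv.toContinuousLinearMap with hW
  set A : L2R →L[ℂ] L2R := W ∘L F (Set.Icc (-a) a) ∘L ContinuousLinearMap.adjoint W with hA
  have hWadj : ∀ ψ : L2R, ContinuousLinearMap.adjoint W ψ = 𝓕⁻ ψ := fun ψ => by
    refine ext_inner_right ℂ fun v => ?_
    rw [ContinuousLinearMap.adjoint_inner_left, ← Lp.inner_fourier_eq (𝓕⁻ ψ) v,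
      FourierTransform.fourier_fourierInv_eq]
    rfl
  have hAψ : ∀ ψ : L2R, A ψ = 𝓕 (F (Set.Icc (-a) a) (𝓕⁻ ψ)) := fun ψ => by
    rw [hA, ContinuousLinearMap.comp_apply, ContinuousLinearMap.comp_apply, hWadj]
    rfl
  have hAinner : ∀ ψ : L2R, (inner ℂ ψ (A ψ) : ℂ)
      = inner ℂ (𝓕⁻ ψ) (F (Set.Icc (-a) a) (𝓕⁻ ψ)) := fun ψ => by
    rw [hAψ, ← Lp.inner_fourier_eq (𝓕⁻ ψ), FourierTransform.fourier_fourierInv_eq]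
  have hinv : ∀ ψ : L2R, ‖(𝓕⁻ ψ : L2R)‖ = ‖ψ‖ := fun ψ =>
    (Lp.fourierTransformₗᵢ ℝ ℂ).symm.norm_map ψ
  obtain ⟨R, hR⟩ := _root_.exists_re_inner_add_tail_le (A := A) (q₀ := 2 * a + 1)
    ((F.positive _ measurableSet_Icc).conj_adjoint W)
    (fun p ψ => by
      rw [hAψ, hAψ, fourierInv_boostOp, intertwine_of_conj_eq (norm_translationOp_apply _)
        (hF _ 0 _ measurableSet_Icc).2, fourier_translationOp]
      congr 2
      have := Real.pi_ne_zero
      field_simp)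
    (fun q hq ψ => by
      -- A translation by `q` corresponds to a boost by `2πq`; since `2π ≥ 1`, the required
      -- separation persists.
      have hq' : 2 * a + 1 ≤ |2 * Real.pi * q| := by
        refine hq.trans ?_
        rw [abs_mul, abs_of_pos (by positivity : 0 < 2 * Real.pi)]
        nlinarith [Real.pi_gt_three, abs_nonneg q]
      have h1 := F.re_inner_add_re_inner_le norm_boostOp_apply
        (fun p X hX => (hF 0 p X hX).1) hq' (𝓕⁻ ψ)
      rwa [← fourierInv_translationOp, hinv, ← hAinner, ← hAinner] at h1)
  refine ⟨R, fun ψ => ?_⟩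
  have h1 := hR (𝓕 ψ)
  rwa [hAinner, FourierTransform.fourierInv_fourier_eq, Lp.norm_fourier_eq] at h1

/-! ### Bounding the effect of a bounded set. -/

theorem tendsto_zero_of_re_add_tail_le {s t : ℕ → ℝ} (hs : ∀ n : ℕ, 1 - 1 / ((n : ℝ) + 1) ≤ s n)
    (h0 : ∀ n, 0 ≤ t n) (h : ∀ n, s n + 1 / 3 * t n ≤ 1) :
    Filter.Tendsto t Filter.atTop (nhds 0) := by
  have h1 : Filter.Tendsto (fun n : ℕ => 3 * (1 / ((n : ℝ) + 1))) Filter.atTop (nhds 0) := by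
    simpa using tendsto_one_div_add_atTop_nhds_zero_nat.const_mul (3 : ℝ)
  refine squeeze_zero h0 (fun n => ?_) h1
  linarith [hs n, h n]

/-- The effects which a joint observable of position and momentum assigns to a bounded set are
bounded away from the identity. -/
theorem IsJointObservable.exists_re_inner_le {E F : Observable ℝ L2R}
    (hE : IsPositionObservable E) (hF : IsMomentumObservable F) {G : Observable (ℝ × ℝ) L2R}
    (hG : IsJointObservable G E F) {Z : Set (ℝ × ℝ)} (hZm : MeasurableSet Z)
    (hZb : Bornology.IsBounded Z) :
    ∃ k : ℝ, 0 ≤ k ∧ k < 1 ∧ ∀ φ : L2R, (inner ℂ φ (G Z φ)).re ≤ k * ‖φ‖ ^ 2 := by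
  obtain ⟨a, ha⟩ := hZb.subset_closedBall 0
  obtain ⟨R, hR⟩ := hE.exists_re_inner_add_tail_le a
  obtain ⟨R', hR'⟩ := hF.exists_re_inner_add_tail_le a
  have hZE : ∀ φ : L2R, (inner ℂ φ (G Z φ)).re ≤ (inner ℂ φ (E (Set.Icc (-a) a) φ)).re := by
    intro φ
    rw [hG.1 _ measurableSet_Icc]
    refine G.re_inner_mono hZm (measurableSet_Icc.prod .univ) (fun z hz => ⟨?_, trivial⟩) φ
    exact abs_le.1 ((norm_fst_le z).trans (mem_closedBall_zero_iff.1 (ha hz)))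
  have hZF : ∀ φ : L2R, (inner ℂ φ (G Z φ)).re ≤ (inner ℂ φ (F (Set.Icc (-a) a) φ)).re := by
    intro φ
    rw [hG.2 _ measurableSet_Icc]
    refine G.re_inner_mono hZm (MeasurableSet.univ.prod measurableSet_Icc)
      (fun z hz => ⟨trivial, ?_⟩) φ
    exact abs_le.1 ((norm_snd_le z).trans (mem_closedBall_zero_iff.1 (ha hz)))
  -- Otherwise every `k = 1 - 1/(n+1)` is exceeded, and normalizing the witnesses gives unit vectors
  -- on which the form of `G Z` tends to one.
  by_contra! hcon
  have hunit : ∀ n : ℕ, ∃ φ : L2R, ‖φ‖ = 1 ∧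
      1 - 1 / ((n : ℝ) + 1) ≤ (inner ℂ φ (G Z φ)).re := by
    intro n
    have hn : (0 : ℝ) < 1 / ((n : ℝ) + 1) := by positivity
    have hn' : 1 / ((n : ℝ) + 1) ≤ 1 := by
      rw [div_le_one (by positivity)]
      linarith [n.cast_nonneg (α := ℝ)]
    obtain ⟨φ, hφ⟩ := hcon (1 - 1 / ((n : ℝ) + 1)) (by linarith) (by linarith)
    have hφ0 : ‖φ‖ ≠ 0 := fun h => by
      rw [norm_eq_zero] at h
      simp [h] at hφ
    refine ⟨((‖φ‖⁻¹ : ℝ) : ℂ) • φ, ?_, ?_⟩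
    · rw [norm_smul, Complex.norm_real, norm_inv, norm_norm, inv_mul_cancel₀ hφ0]
    · rw [map_smul, inner_smul_left, inner_smul_right, Complex.conj_ofReal, ← mul_assoc,
        ← Complex.ofReal_mul, Complex.re_ofReal_mul]
      calc 1 - 1 / ((n : ℝ) + 1) = ‖φ‖⁻¹ * ‖φ‖⁻¹ * ((1 - 1 / ((n : ℝ) + 1)) * ‖φ‖ ^ 2) := by
            field_simp
        _ ≤ _ := by gcongr
  choose φ hφ1 hφ2 using hunit
  refine not_tendsto_tail_fourier_tail (R := R) (R' := R') hφ1
    (tendsto_zero_of_re_add_tail_le hφ2 (fun n => integral_nonneg fun x => by positivity)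
      fun n => ?_)
    (tendsto_zero_of_re_add_tail_le hφ2 (fun n => integral_nonneg fun x => by positivity)
      fun n => ?_)
  · have := hR (φ n)
    rw [hφ1, one_pow] at this
    linarith [hZE (φ n)]
  · have := hR' (φ n)
    rw [hφ1, one_pow] at this
    linarith [hZF (φ n)]

theorem mainTheorem3 (E F : Observable ℝ L2R) (hE : IsPositionObservable E)
    (hF : IsMomentumObservable F) (G : Observable (ℝ × ℝ) L2R) (hG : IsJointObservable G E F)
    (Z : Set (ℝ × ℝ)) (hZm : MeasurableSet Z) (hZb : Bornology.IsBounded Z) :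
    ‖G Z‖ ≠ 1 ∧
    ∃ k : ℝ, k < 1 ∧ ∀ T : L2R →L[ℂ] L2R, IsState T →
      HasTrace (T ∘L G Z) (outcomeProb G T Z : ℂ) ∧ outcomeProb G T Z ≤ k := by
  obtain ⟨k, hk0, hk1, hk⟩ := hG.exists_re_inner_le hE hF hZm hZb
  have hpos := G.positive Z hZm
  refine ⟨((hpos.norm_le_of_re_inner_le hk0 hk).trans_lt hk1).ne, k, hk1, fun T hT => ?_⟩
  obtain ⟨t, ht, htk⟩ := hT.exists_hasTrace_comp hpos hk
  have h1 : outcomeProb G T Z = t := by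
    rw [outcomeProb, ht.opTrace_eq, Complex.ofReal_re]
  rw [h1]
  exact ⟨ht, htk⟩
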